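/- For a group $G$ let $\mathcal{L}_G$ be the lattice of all (not necessarily Hausdorff) group topologies on $G$, ordered by $\sigma\le\tau$ if and only if $\tau$ is finer than $\sigma$ (that is, $\sigma\subseteq\tau$). In a lattice write $b\prec a$ ("$a$ covers $b$") if $b<a$ and there is no $c$ with $b<c<a$, and $b\preceq a$ if $b\prec a$ or $b=a$. A lattice is called semi-modular if $b\prec a$ implies $b\vee c\preceq a\vee c$ for all elements $a,b,c$. A chain $C$ refines a chain $D$ if $D\subseteq C$ and every $c\in C$ satisfies $d_1\le c\le d_2$ for some $d_1,d_2\in D$; a chain is non-refinable if no chain other than itself refines it. The length of a finite non-empty chain is the number of its elements minus one. Theorem. Let $G$ be a nilpotent group. Then: (i) the lattice $\mathcal{L}_G$ is semi-modular; (ii) for all $a,b\in\mathcal{L}_G$, any two finite non-refinable chains in $\mathcal{L}_G$ with least element $a$ and greatest element $b$ have the same length. -/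

import Mathlib

/-- The lattice of all (not necessarily Hausdorff) group topologies on the group `G`, in which
`σ ≤ τ` means that `τ` is finer than `σ`. Mathlib's order on topologies is the opposite one
(smaller is finer), hence the order dual. -/
abbrev GroupTopologyLattice (G : Type*) [Group G] : Type _ := (GroupTopology G)ᵒᵈ

/-- The order is inclusion of the families of open sets. -/
theorem GroupTopologyLattice.le_iff {G : Type*} [Group G] (σ τ : GroupTopologyLattice G) :
    σ ≤ τ ↔ ∀ U : Set G, (OrderDual.ofDual σ).toTopologicalSpace.IsOpen U →
      (OrderDual.ofDual τ).toTopologicalSpace.IsOpen U :=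
  Iff.rfl

/-- The upper covering condition: if `a` covers `b`, then for every `c` the join `a ⊔ c` either
covers or equals `b ⊔ c` (in a partial order `x ⩿ y` says that `y` covers or equals `x`). -/
def IsSemimodularLattice (L : Type*) [Lattice L] : Prop :=
  ∀ a b c : L, b ⋖ a → b ⊔ c ⩿ a ⊔ c

/-- `C` refines `D`: it contains `D`, and each of its elements lies between two elements of `D`. -/
def Refines {P : Type*} [PartialOrder P] (C D : Set P) : Prop :=
  D ⊆ C ∧ ∀ c ∈ C, ∃ d₁ ∈ D, ∃ d₂ ∈ D, d₁ ≤ c ∧ c ≤ d₂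

/-- A non-refinable chain: a chain such that no other chain refines it. -/
def IsNonRefinableChain {P : Type*} [PartialOrder P] (C : Set P) : Prop :=
  IsChain (· ≤ ·) C ∧ ∀ D : Set P, IsChain (· ≤ ·) D → Refines D C → D = C

/-- `C` is a non-refinable chain with least element `a` and greatest element `b`. -/
def IsNonRefinableChainBetween {P : Type*} [PartialOrder P] (a b : P) (C : Set P) : Prop :=
  IsNonRefinableChain C ∧ IsLeast C a ∧ IsGreatest C b

/-- The length of a finite non-empty chain: the number of its elements minus one. -/
noncomputable def chainLength {P : Type*} (C : Set P) : ℕ := C.ncard - 1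

/-! A group topology is determined by its neighbourhood filter at `1`. In Mathlib's order (smaller
is finer), (i) says that `s ⋖ t` gives `s ⊓ c ⩿ t ⊓ c`. Suppose `s ⊓ c < d < t ⊓ c`. If the product
filter of `s` and `d` is again a group filter, it lies between `s` and `t`, so it is one of them. If
it is `s`, then `d ≤ s ⊓ c`; if it is `t`, the modular identity gives `t ⊓ c ≤ d`. Both are absurd.

Nilpotency makes the product a group filter. Some step `M ≤ N` of the upper central series has `t`
finer than `s * N` but not than `s * M`; the cover then forces `t ⊓ M ≤ s`. As `[N, G] ≤ M`,
commutators of `t`-small with `s`-small elements are `s`-small (`tendsto_commutator`).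

Part (ii) is the Jordan–Hölder exchange argument (`exists_of_covBy`). -/

open Filter Topology Set
open scoped Pointwise commutatorElement

/-! ### Group filters and their products -/

section GroupFilter

variable {G : Type*} [Group G]

/-- A filter that is the filter of neighbourhoods of `1` in some group topology. -/
structure IsGroupFilter (F : Filter G) : Prop where
  one : pure 1 ≤ F
  mul : F * F ≤ F
  inv : F⁻¹ ≤ F
  conj : ∀ g : G, Tendsto (fun x => g * x * g⁻¹) F F

namespace IsGroupFilter

theorem tendsto_mul {α : Type*} {l : Filter α} {F : Filter G} (hF : IsGroupFilter F)
    {f g : α → G} (hf : Tendsto f l F) (hg : Tendsto g l F) :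
    Tendsto (fun x => f x * g x) l F := by
  have h : Tendsto (fun p : G × G => p.1 * p.2) (F ×ˢ F) F := by
    rw [Tendsto, map_prod_eq_map₂ (fun x y : G => x * y)]
    exact hF.mul
  exact h.comp (hf.prodMk hg)

theorem tendsto_inv {α : Type*} {l : Filter α} {F : Filter G} (hF : IsGroupFilter F)
    {f : α → G} (hf : Tendsto f l F) : Tendsto (fun x => (f x)⁻¹) l F :=
  (show Tendsto (fun x : G => x⁻¹) F F from hF.inv).comp hf

theorem one_mem {F : Filter G} (hF : IsGroupFilter F) {U : Set G} (hU : U ∈ F) : (1 : G) ∈ U :=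
  mem_pure.1 (hF.one hU)

theorem inf {A B : Filter G} (hA : IsGroupFilter A) (hB : IsGroupFilter B) :
    IsGroupFilter (A ⊓ B) where
  one := le_inf hA.one hB.one
  mul := le_inf ((mul_le_mul' inf_le_left inf_le_left).trans hA.mul)
    ((mul_le_mul' inf_le_right inf_le_right).trans hB.mul)
  inv := le_inf ((Filter.map_mono inf_le_left).trans hA.inv)
    ((Filter.map_mono inf_le_right).trans hB.inv)
  conj g := (hA.conj g).inf (hB.conj g)

/-- The principal filter of a normal subgroup. -/
theorem principal (N : Subgroup G) [hN : N.Normal] : IsGroupFilter (𝓟 (N : Set G)) where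
  one := by simp
  mul := by
    intro U hU
    refine Filter.mem_of_superset (Filter.mul_mem_mul (mem_principal_self _)
      (mem_principal_self _)) ?_
    rintro _ ⟨x, hx, y, hy, rfl⟩
    exact hU (N.mul_mem hx hy)
  inv := by
    refine tendsto_principal_principal.2 fun x hx => N.inv_mem hx
  conj g := tendsto_principal_principal.2 fun x hx => hN.conj_mem x hx g

theorem le_mul_left {A D : Filter G} (hD : IsGroupFilter D) : A ≤ A * D :=
  calc A = A * pure 1 := by rw [Filter.pure_one, mul_one]
    _ ≤ A * D := mul_le_mul' le_rfl hD.one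

theorem le_mul_right {A D : Filter G} (hA : IsGroupFilter A) : D ≤ A * D :=
  calc D = pure 1 * D := by rw [Filter.pure_one, one_mul]
    _ ≤ A * D := mul_le_mul' hA.one le_rfl

/-- The product of two group filters is a group filter as soon as they commute weakly. -/
theorem mul_of_le {A D : Filter G} (hA : IsGroupFilter A) (hD : IsGroupFilter D)
    (h : D * A ≤ A * D) : IsGroupFilter (A * D) where
  one := hA.one.trans hD.le_mul_left
  mul :=
    calc A * D * (A * D) = A * (D * A) * D := by simp only [mul_assoc]
      _ ≤ A * (A * D) * D := mul_le_mul' (mul_le_mul' le_rfl h) le_rfl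
      _ = A * A * (D * D) := by simp only [mul_assoc]
      _ ≤ A * D := mul_le_mul' hA.mul hD.mul
  inv :=
    calc (A * D)⁻¹ = D⁻¹ * A⁻¹ := mul_inv_rev A D
      _ ≤ D * A := mul_le_mul' hD.inv hA.inv
      _ ≤ A * D := h
  conj g := by
    have hm : map (MulAut.conj g) (A * D) = map (MulAut.conj g) A * map (MulAut.conj g) D :=
      Filter.map_mul (MulAut.conj g)
    exact hm.le.trans (mul_le_mul' (hA.conj g) (hD.conj g))

/-- If commutators are small for `A`, then the product with `A` is a group filter. -/
theorem mul_of_tendsto_commutator {A D : Filter G} (hA : IsGroupFilter A) (hD : IsGroupFilter D)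
    (h : Tendsto (fun p : G × G => ⁅p.1, p.2⁆) (D ×ˢ A) A) : IsGroupFilter (A * D) := by
  refine hA.mul_of_le hD ?_
  have h' : Tendsto (fun p : G × G => (⁅p.1, p.2⁆ * p.2) * p.1) (D ×ˢ A) (A * D) := by
    have h₁ := hA.tendsto_mul h tendsto_snd
    have h₂ : Tendsto (fun q : G × G => q.1 * q.2) (A ×ˢ D) (A * D) := by
      rw [Tendsto, map_prod_eq_map₂ (fun x y : G => x * y)]
      exact le_rfl
    exact h₂.comp (h₁.prodMk tendsto_fst)
  have he : (fun p : G × G => (⁅p.1, p.2⁆ * p.2) * p.1) = fun p => p.1 * p.2 := by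
    funext p
    simp [commutatorElement_def]
  rw [he, Tendsto, map_prod_eq_map₂ (fun x y : G => x * y)] at h'
  exact h'

theorem mul_principal {A : Filter G} (hA : IsGroupFilter A) (N : Subgroup G) [hN : N.Normal] :
    IsGroupFilter (A * 𝓟 (N : Set G)) := by
  refine hA.mul_of_le (principal N) fun U hU => ?_
  obtain ⟨V, hV, W, hW, hVW⟩ := Filter.mem_mul.1 hU
  refine Filter.mem_of_superset (Filter.mul_mem_mul (mem_principal_self _) hV) ?_
  rintro _ ⟨n, hn, v, hv, rfl⟩
  have : n * v = v * (v⁻¹ * n * v) := by group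
  simp only [this]
  refine hVW (Set.mul_mem_mul hv (hW ?_))
  simpa using hN.conj_mem n hn v⁻¹

/-- If `A` is finer than `B`, agrees with `B` on `M` and modulo `N`, and `[N, G] ≤ M`, then
commutators of `B`-small and `A`-small elements are `A`-small. -/
theorem tendsto_commutator {A B : Filter G} (hA : IsGroupFilter A) (hB : IsGroupFilter B)
    (hAB : A ≤ B) {M N : Subgroup G} (hNM : ∀ z ∈ N, ∀ u : G, ⁅z, u⁆ ∈ M)
    (hM : B ⊓ 𝓟 (M : Set G) ≤ A) (hN : B ≤ A * 𝓟 (N : Set G)) :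
    Tendsto (fun p : G × G => ⁅p.1, p.2⁆) (B ×ˢ A) A := by
  intro U hU
  -- For `w = x * z`, `⁅w, u⁆ = x * ⁅z, u⁆ * u * x⁻¹ * u⁻¹`; the middle slot will receive `⁅z, u⁆`.
  have h1 : Tendsto (fun p : G × G × G => p.1 * p.2.1 * p.2.2 * p.1⁻¹ * p.2.2⁻¹)
      (A ×ˢ A ×ˢ A) A := by
    have a1 : Tendsto (fun p : G × G × G => p.1) (A ×ˢ A ×ˢ A) A := tendsto_fst
    have a2 : Tendsto (fun p : G × G × G => p.2.1) (A ×ˢ A ×ˢ A) A :=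
      tendsto_fst.comp tendsto_snd
    have a3 : Tendsto (fun p : G × G × G => p.2.2) (A ×ˢ A ×ˢ A) A :=
      tendsto_snd.comp tendsto_snd
    exact hA.tendsto_mul (hA.tendsto_mul (hA.tendsto_mul (hA.tendsto_mul a1 a2) a3)
      (hA.tendsto_inv a1)) (hA.tendsto_inv a3)
  -- Since `z = x⁻¹ * w`, the commutator `⁅z, u⁆` is `B`-small; lying in `M`, it is then `A`-small.
  have h2 : Tendsto (fun p : G × G × G => ⁅p.1⁻¹ * p.2.1, p.2.2⁆) (B ×ˢ B ×ˢ B) B := by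
    have b1 : Tendsto (fun p : G × G × G => p.1⁻¹) (B ×ˢ B ×ˢ B) B :=
      hB.tendsto_inv tendsto_fst
    have b2 : Tendsto (fun p : G × G × G => p.2.1) (B ×ˢ B ×ˢ B) B :=
      tendsto_fst.comp tendsto_snd
    have b3 : Tendsto (fun p : G × G × G => p.2.2) (B ×ˢ B ×ˢ B) B :=
      tendsto_snd.comp tendsto_snd
    have b12 := hB.tendsto_mul b1 b2
    simp only [commutatorElement_def]
    exact hB.tendsto_mul (hB.tendsto_mul (hB.tendsto_mul b12 b3) (hB.tendsto_inv b12))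
      (hB.tendsto_inv b3)
  obtain ⟨P, hP, Q, hQ, hPQ⟩ := mem_prod_iff.1 (h1 hU)
  obtain ⟨Q₁, hQ₁, Q₂, hQ₂, hQQ⟩ := mem_prod_iff.1 hQ
  have hV := mem_inf_principal.1 (hM hQ₁)
  obtain ⟨X, hX, Y, hY, hXY⟩ := mem_prod_iff.1 (h2 hV)
  obtain ⟨Y₁, hY₁, Y₂, hY₂, hYY⟩ := mem_prod_iff.1 hY
  have hW : (P ∩ X) * (N : Set G) ∈ B :=
    hN (Filter.mul_mem_mul (inter_mem hP (hAB hX)) (mem_principal_self _))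
  refine mem_map.2 (Filter.mem_of_superset
    (prod_mem_prod (inter_mem hY₁ hW) (inter_mem hQ₂ (hAB hY₂))) ?_)
  rintro ⟨w, u⟩ ⟨⟨hwY, x, hx, z, hz, rfl⟩, hu, huY⟩
  have hzV : ⁅z, u⁆ ∈ (M : Set G) → ⁅z, u⁆ ∈ Q₁ := by
    have := hXY (Set.mk_mem_prod hx.2 (hYY (Set.mk_mem_prod hwY huY)))
    simpa using this
  have := hPQ (Set.mk_mem_prod hx.1 (hQQ (Set.mk_mem_prod (hzV (hNM z hz u)) hu)))
  simpa [commutatorElement_def, mul_assoc] using this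

/-- The modular identity for a product of group filters. -/
theorem inf_le_of_le_mul {A B C D : Filter G} (hC : IsGroupFilter C) (hD : IsGroupFilter D)
    (hACD : A ⊓ C ≤ D) (hDC : D ≤ C) (hB : B ≤ A * D) : B ⊓ C ≤ D := by
  intro W hW
  obtain ⟨W₁, hW₁, W₂, hW₂, hWW⟩ := Filter.mem_mul.1 (hD.mul hW)
  obtain ⟨U, hU, Y, hY, hUY⟩ := mem_inf_iff_superset.1 (hACD hW₁)
  have hdiv : Tendsto (fun p : G × G => p.1 * p.2⁻¹) (C ×ˢ C) C :=
    hC.tendsto_mul tendsto_fst (hC.tendsto_inv tendsto_snd)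
  obtain ⟨Y₁, hY₁, Y₂, hY₂, hYY⟩ := mem_prod_iff.1 (hdiv hY)
  -- If `u * w` and `w` are both `C`-small, so is `u = (u * w) * w⁻¹`, hence `u` is `D`-small.
  refine mem_inf_iff_superset.2 ⟨_, hB (Filter.mul_mem_mul hU (inter_mem hW₂ (hDC hY₂))), Y₁,
    hY₁, ?_⟩
  rintro _ ⟨⟨u, hu, w, hw, rfl⟩, hx⟩
  refine hWW (Set.mul_mem_mul (hUY ⟨hu, ?_⟩) hw.1)
  simpa using hYY (Set.mk_mem_prod hx hw.2)

end IsGroupFilter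

end GroupFilter

/-! ### Group topologies and covers in the nilpotent case -/

namespace GroupTopology

variable {G : Type*} [Group G]

/-- The filter of neighbourhoods of `1`. -/
def nhdsOne (t : GroupTopology G) : Filter G := @nhds G t.toTopologicalSpace 1

theorem isGroupFilter_nhdsOne (t : GroupTopology G) : IsGroupFilter t.nhdsOne := by
  let := t.toTopologicalSpace
  have := t.toIsTopologicalGroup
  change IsGroupFilter (𝓝 (1 : G))
  refine ⟨pure_le_nhds 1, ?_, ?_, fun g => ?_⟩
  · rw [nhds_mul_nhds_one]
  · exact (nhds_one_symm' (G := G)).le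
  · have : Continuous fun x : G => g * x * g⁻¹ := by fun_prop
    simpa using this.tendsto 1

theorem nhdsOne_le_iff {s t : GroupTopology G} : s.nhdsOne ≤ t.nhdsOne ↔ s ≤ t := by
  rw [← toTopologicalSpace_le]
  have := s.toIsTopologicalGroup
  have := t.toIsTopologicalGroup
  refine ⟨fun h => le_of_nhds_le_nhds fun x => ?_, fun h => nhds_mono h⟩
  rw [← @nhds_translation_mul_inv G s.toTopologicalSpace _ _ x,
    ← @nhds_translation_mul_inv G t.toTopologicalSpace _ _ x]
  exact comap_mono h

theorem nhdsOne_inf (s t : GroupTopology G) : (s ⊓ t).nhdsOne = s.nhdsOne ⊓ t.nhdsOne := by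
  rw [nhdsOne, toTopologicalSpace_inf, nhds_inf]
  rfl

theorem exists_nhdsOne_eq {F : Filter G} (hF : IsGroupFilter F) :
    ∃ t : GroupTopology G, t.nhdsOne = F := by
  let B : GroupFilterBasis G :=
    { sets := F.sets
      nonempty := ⟨univ, univ_mem⟩
      inter_sets := fun {x y} hx hy => ⟨x ∩ y, inter_mem hx hy, subset_rfl⟩
      one' := fun hU => hF.one_mem hU
      mul' := fun {U} hU => by
        obtain ⟨V, hV, W, hW, hVW⟩ := Filter.mem_mul.1 (hF.mul hU)
        exact ⟨V ∩ W, inter_mem hV hW,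
          (Set.mul_subset_mul inter_subset_left inter_subset_right).trans hVW⟩
      inv' := fun {U} hU => ⟨_, hF.inv hU, subset_rfl⟩
      conj' := fun g {U} hU => ⟨_, hF.conj g hU, subset_rfl⟩ }
  refine ⟨⟨B.topology, B.isTopologicalGroup⟩, ?_⟩
  refine B.nhds_one_eq.trans ?_
  ext U
  rw [FilterBasis.mem_filter_iff]
  exact ⟨fun ⟨V, hV, hVU⟩ => Filter.mem_of_superset hV hVU, fun h => ⟨U, h, subset_rfl⟩⟩

/-- In a nilpotent group, two distinct comparable group filters differ on one single step of the
upper central series. -/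
theorem exists_upperCentralSeries [Group.IsNilpotent G] {A B : Filter G}
    (hA : IsGroupFilter A) (hBA : ¬ B ≤ A) :
    ∃ n : ℕ, ¬ B ≤ A * 𝓟 (Subgroup.upperCentralSeries G n : Set G) ∧
      B ≤ A * 𝓟 (Subgroup.upperCentralSeries G (n + 1) : Set G) := by
  by_contra! h
  have hall : ∀ n : ℕ, ¬ B ≤ A * 𝓟 (Subgroup.upperCentralSeries G n : Set G) := by
    intro n
    induction n with
    | zero => simpa using hBA
    | succ n ih => exact h n ih
  obtain ⟨n, hn⟩ := Group.IsNilpotent.nilpotent G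
  refine hall n ?_
  rw [hn, Subgroup.coe_top, principal_univ, Filter.mul_top_of_one_le hA.one]
  exact le_top

/-- Below a covered group topology of a nilpotent group, the products of neighbourhoods of `1`
form the neighbourhoods of `1` in a group topology. -/
theorem isGroupFilter_mul_of_covBy [Group.IsNilpotent G] {s t d : GroupTopology G} (h : s ⋖ t)
    (hd : d ≤ t) : IsGroupFilter (s.nhdsOne * d.nhdsOne) := by
  have hs := s.isGroupFilter_nhdsOne
  have ht := t.isGroupFilter_nhdsOne
  obtain ⟨n, hn, hn'⟩ := exists_upperCentralSeries hs
    (mt nhdsOne_le_iff.1 h.lt.not_ge : ¬ t.nhdsOne ≤ s.nhdsOne)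
  set M := Subgroup.upperCentralSeries G n
  -- This `e` lies between `s` and `t`, and the choice of `n` excludes `e = t`.
  obtain ⟨e, he⟩ := exists_nhdsOne_eq (ht.inf (hs.mul_principal M))
  have hse : s ≤ e := nhdsOne_le_iff.1 (he ▸ le_inf (nhdsOne_le_iff.2 h.le)
    (IsGroupFilter.principal M).le_mul_left)
  have het : e ≤ t := nhdsOne_le_iff.1 (he ▸ inf_le_left)
  have hM : t.nhdsOne ⊓ 𝓟 (M : Set G) ≤ s.nhdsOne := by
    rcases h.eq_or_eq hse het with rfl | rfl
    · exact (inf_le_inf_left _ hs.le_mul_right).trans he.ge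
    · exact absurd (inf_eq_left.1 he.symm) hn
  refine hs.mul_of_tendsto_commutator d.isGroupFilter_nhdsOne ?_
  refine (hs.tendsto_commutator ht (nhdsOne_le_iff.2 h.le) (fun z hz u => ?_) hM hn').mono_left
    (Filter.prod_mono_left _ (nhdsOne_le_iff.2 hd))
  exact Subgroup.mem_upperCentralSeries_succ_iff.1 hz u

theorem inf_wcovBy_inf [Group.IsNilpotent G] {s t : GroupTopology G} (h : s ⋖ t)
    (c : GroupTopology G) : s ⊓ c ⩿ t ⊓ c := by
  refine ⟨inf_le_inf_right c h.le, fun d hsd hdt => ?_⟩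
  have hd : d ≤ t := hdt.le.trans inf_le_left
  have hdc : d ≤ c := hdt.le.trans inf_le_right
  obtain ⟨e, he⟩ := exists_nhdsOne_eq (isGroupFilter_mul_of_covBy h hd)
  have hse : s ≤ e := nhdsOne_le_iff.1 (he ▸ d.isGroupFilter_nhdsOne.le_mul_left)
  have hde : d ≤ e := nhdsOne_le_iff.1 (he ▸ s.isGroupFilter_nhdsOne.le_mul_right)
  have het : e ≤ t := nhdsOne_le_iff.1 (he ▸ (mul_le_mul' (nhdsOne_le_iff.2 h.le)
    (nhdsOne_le_iff.2 hd)).trans t.isGroupFilter_nhdsOne.mul)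
  rcases h.eq_or_eq hse het with rfl | rfl
  · exact hsd.not_ge (le_inf hde hdc)
  · refine hdt.not_ge (nhdsOne_le_iff.1 ?_)
    rw [nhdsOne_inf]
    refine c.isGroupFilter_nhdsOne.inf_le_of_le_mul d.isGroupFilter_nhdsOne ?_
      (nhdsOne_le_iff.2 hdc) he.le
    rw [← nhdsOne_inf]
    exact nhdsOne_le_iff.2 hsd.le

end GroupTopology

theorem GroupTopologyLattice.isSemimodularLattice (G : Type*) [Group G] [Group.IsNilpotent G] :
    IsSemimodularLattice (GroupTopologyLattice G) := fun _ _ c h =>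
  ofDual_wcovBy_ofDual_iff.1
    (GroupTopology.inf_wcovBy_inf (ofDual_covBy_ofDual_iff.2 h) (OrderDual.ofDual c))

/-! ### Lengths of chains in semi-modular lattices -/

/-- `CovByPath n a b`: there is a sequence of `n` successive covers from `a` to `b`. -/
inductive CovByPath {P : Type*} [PartialOrder P] : ℕ → P → P → Prop
  | refl (a : P) : CovByPath 0 a a
  | cons {n : ℕ} {a b c : P} (hab : a ⋖ b) (hbc : CovByPath n b c) : CovByPath (n + 1) a c

namespace CovByPath

theorem le {P : Type*} [PartialOrder P] {n : ℕ} {a b : P} (h : CovByPath n a b) : a ≤ b := by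
  induction h with
  | refl a => exact le_rfl
  | cons h _ ih => exact h.le.trans ih

/-- Exchange step: if the path starts with `a ⋖ c` and `c ≠ d`, then `d ⊔ c` covers both `c` and
`d`. By induction the rest of the path can be rerouted through `d ⊔ c`, and its first step replaced
by `d ⋖ d ⊔ c`. -/
theorem exists_of_covBy {L : Type*} [Lattice L] (hL : IsSemimodularLattice L) {n : ℕ} {a b d : L}
    (h : CovByPath n a b) (had : a ⋖ d) (hdb : d ≤ b) : ∃ m, n = m + 1 ∧ CovByPath m d b := by
  induction h generalizing d with
  | refl a => exact absurd hdb had.lt.not_ge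
  | @cons n a c _ hac hcb ih =>
    by_cases hcd : c = d
    · exact ⟨n, rfl, hcd ▸ hcb⟩
    have hdc : ¬ d ≤ c := fun hle =>
      (hac.eq_or_eq had.le hle).elim had.ne' (Ne.symm hcd)
    have hcd' : ¬ c ≤ d := fun hle =>
      (had.eq_or_eq hac.le hle).elim hac.ne' hcd
    have h₁ : c ⋖ d ⊔ c := by
      have := hL d a c had
      rw [sup_eq_right.2 hac.le] at this
      exact this.covBy_of_ne fun he => hdc (he ▸ le_sup_left)
    have h₂ : d ⋖ d ⊔ c := by
      have := hL c a d hac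
      rw [sup_eq_right.2 had.le, sup_comm] at this
      exact this.covBy_of_ne fun he => hcd' (he ▸ le_sup_right)
    obtain ⟨m, rfl, hm⟩ := ih h₁ (sup_le hdb hcb.le)
    exact ⟨m + 1, rfl, cons h₂ hm⟩

theorem length_unique {L : Type*} [Lattice L] (hL : IsSemimodularLattice L) {m n : ℕ} {a b : L}
    (h : CovByPath m a b) (h' : CovByPath n a b) : m = n := by
  induction h generalizing n with
  | refl a =>
    cases h' with
    | refl => rfl
    | cons hac hca => exact absurd hca.le hac.lt.not_ge
  | cons hac hcb ih =>
    obtain ⟨k, rfl, hk⟩ := exists_of_covBy hL h' hac hcb.le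
    rw [ih hk]

/-- A finite chain containing every element between its bounds `a` and `b` that is comparable to
all its elements gives a path of covers. -/
theorem of_saturated {P : Type*} [PartialOrder P] {n : ℕ} {a b : P} {C : Set P}
    (hn : C.ncard = n + 1) (hC : IsChain (· ≤ ·) C) (ha : IsLeast C a) (hb : IsGreatest C b)
    (hsat : ∀ x, a ≤ x → x ≤ b → (∀ c ∈ C, x ≤ c ∨ c ≤ x) → x ∈ C) : CovByPath n a b := by
  induction n generalizing a C with
  | zero =>
    obtain ⟨x, rfl⟩ := Set.ncard_eq_one.1 hn
    have h₁ := ha.1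
    have h₂ := hb.1
    rw [mem_singleton_iff] at h₁ h₂
    subst h₁ h₂
    exact refl _
  | succ n ih =>
    have hfin : C.Finite := Set.finite_of_ncard_ne_zero (by omega)
    have hcard : (C \ {a}).ncard = n + 1 := by
      rw [Set.ncard_sdiff_singleton_of_mem ha.1]
      omega
    have hne : (C \ {a}).Nonempty := Set.nonempty_of_ncard_ne_zero (by omega)
    have hC' : IsChain (· ≤ ·) (C \ {a}) := hC.mono sdiff_subset
    obtain ⟨c, hc⟩ := (hfin.subset sdiff_subset : (C \ {a}).Finite).exists_minimal hne
    have hcl : ∀ x ∈ C \ {a}, c ≤ x := fun x hx =>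
      (hC'.total hc.1 hx).elim id fun h => hc.2 hx h
    have hac : a < c := lt_of_le_of_ne (ha.2 hc.1.1) (Ne.symm hc.1.2)
    have hcb : c ≤ b := hb.2 hc.1.1
    refine cons (b := c) ⟨hac, fun x hax hxc => ?_⟩ (ih hcard hC' ⟨hc.1, hcl⟩
      ⟨⟨hb.1, (hac.trans_le hcb).ne'⟩, fun x hx => hb.2 hx.1⟩ fun x hcx hxb hx => ?_)
    · have hxC : x ∈ C := hsat x hax.le (hxc.le.trans hcb) fun y hy => by
        by_cases hya : y = a
        · exact Or.inr (hya ▸ hax.le)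
        · exact Or.inl (hxc.le.trans (hcl y ⟨hy, hya⟩))
      exact hxc.not_ge (hcl x ⟨hxC, hax.ne'⟩)
    · refine ⟨hsat x (hac.le.trans hcx) hxb fun y hy => ?_, (hac.trans_le hcx).ne'⟩
      by_cases hya : y = a
      · exact Or.inr (hya ▸ hac.le.trans hcx)
      · exact hx y ⟨hy, hya⟩

theorem of_isNonRefinableChainBetween {P : Type*} [PartialOrder P] {a b : P} {C : Set P}
    (hfin : C.Finite) (h : IsNonRefinableChainBetween a b C) :
    CovByPath (chainLength C) a b := by
  obtain ⟨⟨hC, hmax⟩, ha, hb⟩ := h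
  have hpos : 0 < C.ncard := (Set.ncard_pos hfin).2 ⟨a, ha.1⟩
  refine of_saturated (by rw [chainLength]; omega) hC ha hb fun x hax hxb hx => ?_
  -- Adding `x` gives a chain refining `C`, so it adds nothing.
  rw [← hmax (insert x C) (hC.insert fun c hc _ => hx c hc) ⟨subset_insert x C, ?_⟩]
  · exact mem_insert x C
  · rintro c (rfl | hc)
    · exact ⟨a, ha.1, b, hb.1, hax, hxb⟩
    · exact ⟨c, hc, c, hc, le_rfl, le_rfl⟩

end CovByPath

theorem mainTheorem3 (G : Type*) [Group G] [Group.IsNilpotent G] :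
    IsSemimodularLattice (GroupTopologyLattice G) ∧
      ∀ (a b : GroupTopologyLattice G) (C D : Set (GroupTopologyLattice G)),
        C.Finite → D.Finite →
        IsNonRefinableChainBetween a b C → IsNonRefinableChainBetween a b D →
        chainLength C = chainLength D :=
  ⟨GroupTopologyLattice.isSemimodularLattice G, fun _ _ _ _ hC hD h h' =>
    (CovByPath.of_isNonRefinableChainBetween hC h).length_unique
      (GroupTopologyLattice.isSemimodularLattice G)
      (CovByPath.of_isNonRefinableChainBetween hD h')⟩
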